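/- Let $V$ be a finite set of nodes and $W\in\mathbb{R}^{V\times V}$ a symmetric matrix with non-negative entries, viewed as the weighted adjacency matrix of an undirected graph whose edges are the pairs $\{i,j\}$, $i\neq j$, with $W_{ij}>0$. Let $L=D-W$ with $D=\mathrm{diag}\big(\sum_j W_{ij}\big)_i$, let $q>0$ and $y\in\mathbb{R}^V$. A rooted spanning forest $\phi$ is an acyclic subgraph containing all nodes, together with a set $\rho(\phi)$ of roots containing exactly one node of each connected component (tree) of $\phi$. Let $\Phi_q$ be a random rooted spanning forest, defined on an arbitrary probability space, with law $$\mathbb{P}(\Phi_q=\phi)\;\propto\; q^{|\rho(\phi)|}\prod_{\{i,j\}\in\phi}W_{ij}.$$ For $i\in V$ let $T(i)\subseteq V$ be the set of nodes of the tree of $\Phi_q$ containing $i$, and put $$\bar x(i)=\frac{1}{|T(i)|}\sum_{j\in T(i)}y_j .$$ Then the matrix $qI+L$ is invertible and, with $K=q(qI+L)^{-1}$, the vector $\hat x=Ky$ is the unique minimiser over $z\in\mathbb{R}^V$ of $q\|y-z\|^2+z^tLz$. Moreover $\bar x$ is square-integrable and is an unbiased estimator of $\hat x$, that is $\mathbb{E}[\bar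 x]=\hat x$, and $$\mathbb{E}\big(\|\bar x-\hat x\|^2\big)=\sum_{i\in V}\mathrm{var}(\bar x(i))=y^t(K-K^2)y ,$$ where $\|\cdot\|$ is the Euclidean norm. -/

import Mathlib

open MeasureTheory ProbabilityTheory
open scoped Matrix ENNReal

noncomputable section

/-- An undirected graph on the vertex set `V` with non-negative edge weights, given by its
symmetric weighted adjacency matrix. -/
structure WeightedGraph (V : Type*) where
  W : Matrix V V ℝ
  symm : W.IsSymm
  nonneg : ∀ i j, 0 ≤ W i j

namespace WeightedGraph

variable {V : Type*} (G : WeightedGraph V)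

/-- The underlying simple graph: distinct nodes joined by an edge of positive weight. -/
def toSimpleGraph : SimpleGraph V where
  Adj i j := i ≠ j ∧ 0 < G.W i j
  symm := ⟨fun i j h => ⟨h.1.symm, by rw [G.symm.apply i j]; exact h.2⟩⟩
  loopless := ⟨fun _ h => h.1 rfl⟩

/-- The weight of an unordered pair of nodes. -/
def edgeWeight : Sym2 V → ℝ :=
  Sym2.lift ⟨fun i j => G.W i j, fun i j => (G.symm.apply i j).symm⟩

/-- A rooted spanning forest: a spanning subgraph without cycles, with a set of roots containing
exactly one node of each connected component (tree). The orientation of the edges towards the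
roots is determined by these data. -/
@[ext]
structure RootedForest where
  graph : SimpleGraph V
  roots : Finset V
  le : graph ≤ G.toSimpleGraph
  acyclic : graph.IsAcyclic
  existsUnique_root : ∀ i, ∃! r, r ∈ roots ∧ graph.Reachable i r

instance [Finite V] : Finite G.RootedForest :=
  Finite.of_injective (fun φ : G.RootedForest => (φ.graph, φ.roots)) fun _ _ h =>
    RootedForest.ext (Prod.ext_iff.1 h).1 (Prod.ext_iff.1 h).2

instance : MeasurableSpace G.RootedForest := ⊤

variable [Fintype V]

/-- The combinatorial Laplacian `L = D - W`. -/
def laplacian [DecidableEq V] : Matrix V V ℝ := Matrix.diagonal (fun i => ∑ j, G.W i j) - G.W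

/-- The smoothing matrix `K = q (q I + L)⁻¹`. -/
def smoother [DecidableEq V] (q : ℝ) : Matrix V V ℝ := q • (q • (1 : Matrix V V ℝ) + G.laplacian)⁻¹

/-- The objective `q ‖y - z‖² + zᵗ L z` of the smoothing problem. -/
def objective [DecidableEq V] (q : ℝ) (y z : V → ℝ) : ℝ :=
  q * ‖WithLp.toLp 2 (y - z)‖ ^ 2 + z ⬝ᵥ G.laplacian *ᵥ z

variable {G}

open scoped Classical in
/-- The unnormalised probability of a rooted forest: `q` to the number of roots (that is, of
trees), times the product of the weights of its edges. -/
def RootedForest.weight (φ : G.RootedForest) (q : ℝ) : ℝ :=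
  q ^ φ.roots.card * ∏ e ∈ φ.graph.edgeFinset, G.edgeWeight e

open scoped Classical in
/-- The set of nodes of the tree of `φ` that contains `i`. -/
def RootedForest.tree (φ : G.RootedForest) (i : V) : Finset V :=
  Finset.univ.filter fun j => φ.graph.Reachable i j

/-- The estimator that gives each node the average of `y` over its tree. -/
def RootedForest.treeAverage (φ : G.RootedForest) (y : V → ℝ) (i : V) : ℝ :=
  (1 / ((φ.tree i).card : ℝ)) * ∑ j ∈ φ.tree i, y j

variable (G)

/-- The forest without edges, in which every node is a root. -/
def trivialForest : G.RootedForest where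
  graph := ⊥
  roots := Finset.univ
  le := bot_le
  acyclic := SimpleGraph.isAcyclic_bot
  existsUnique_root i := ⟨i, ⟨Finset.mem_univ i, SimpleGraph.Reachable.refl i⟩,
    fun _ h => (SimpleGraph.reachable_bot.1 h.2).symm⟩

theorem trivialForest_weight (q : ℝ) :
    G.trivialForest.weight q = q ^ Fintype.card V := by
  classical
  unfold RootedForest.weight
  rw [Finset.prod_eq_one, mul_one]
  · simp [trivialForest]
  · intro e he
    have h := SimpleGraph.mem_edgeFinset.1 he
    simp [trivialForest] at h

theorem tsum_weight_ne_zero {q : ℝ} (hq : 0 < q) :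
    ∑' φ : G.RootedForest, ENNReal.ofReal (φ.weight q) ≠ 0 := by
  intro h
  have h0 := ENNReal.tsum_eq_zero.1 h G.trivialForest
  rw [trivialForest_weight, ENNReal.ofReal_eq_zero] at h0
  exact absurd h0 (not_le.2 (pow_pos hq _))

theorem tsum_weight_ne_top (q : ℝ) :
    ∑' φ : G.RootedForest, ENNReal.ofReal (φ.weight q) ≠ ∞ := by
  have := Fintype.ofFinite G.RootedForest
  rw [tsum_fintype]
  exact ENNReal.sum_ne_top.2 fun _ _ => ENNReal.ofReal_ne_top

/-- The law of the random spanning forest `Φ_q`: the probability of each rooted spanning forest is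
proportional to its weight. -/
def forestLaw {q : ℝ} (hq : 0 < q) : PMF G.RootedForest :=
  PMF.normalize (fun φ => ENNReal.ofReal (φ.weight q))
    (G.tsum_weight_ne_zero hq) (G.tsum_weight_ne_top q)

end WeightedGraph

end

/-! Let `R i j` be the total weight of the forests in which `i` has root `j`, and `Z` the total
weight of all forests. The core is the identity `R (q I + L) = q Z I`, which gives both
invertibility and `R = Z K`. It is proved by double counting. In `R i j - R i k` the forests with
`j` and `k` in one tree cancel, by moving the root (`sum_weight_reroot`). In the others, adding the
edge `jk` trades a factor `q` for `W j k` (`mul_sum_weight_join`) and gives a forest whose path from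
`i` to its root runs through `j` and then `k`. Summing over `k` counts the exits of this path from
`j` minus its entries, which is 1 at its start, -1 at its end and 0 elsewhere
(`sum_edge_directions`).

The weight ignores which node of a tree is its root, so given the trees the root of `i` is uniform
on `T(i)`. Hence the averaging matrix `P` of the random forest has mean `K`
(`sum_weight_div_card_tree`), and the estimator is unbiased. As `P` is an orthogonal projection, `‖P
y‖² = y · P y` has mean `y · K y`; subtracting `‖K y‖² = y · K² y` gives the variance. -/

noncomputable section

/-! ### Adding and deleting one edge in a forest. -/

namespace SimpleGraph

variable {V : Type*} {G : SimpleGraph V} {a b x y : V}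

theorem reachable_sup_edge_iff (hab : a ≠ b) :
    (G ⊔ edge a b).Reachable x y ↔ G.Reachable x y ∨
      (G.Reachable x a ∧ G.Reachable b y) ∨ (G.Reachable x b ∧ G.Reachable a y) := by
  have hedge : (G ⊔ edge a b).Reachable a b :=
    Adj.reachable (Or.inr ((edge_adj ..).2 ⟨Or.inl ⟨rfl, rfl⟩, hab⟩))
  constructor
  · rintro ⟨p⟩
    induction p with
    | nil => exact Or.inl (Reachable.refl _)
    | @cons u v w h p ih =>
      rcases h with h | h
      · have h := h.reachable
        rcases ih with ih | ⟨h1, h2⟩ | ⟨h1, h2⟩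
        · exact Or.inl (h.trans ih)
        · exact Or.inr (Or.inl ⟨h.trans h1, h2⟩)
        · exact Or.inr (Or.inr ⟨h.trans h1, h2⟩)
      · rw [edge_adj] at h
        obtain ⟨⟨rfl, rfl⟩ | ⟨rfl, rfl⟩, -⟩ := h
        · rcases ih with ih | ⟨h1, h2⟩ | ⟨h1, h2⟩
          · exact Or.inr (Or.inl ⟨Reachable.refl _, ih⟩)
          · exact Or.inr (Or.inl ⟨Reachable.refl _, h2⟩)
          · exact Or.inl h2
        · rcases ih with ih | ⟨h1, h2⟩ | ⟨h1, h2⟩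
          · exact Or.inr (Or.inr ⟨Reachable.refl _, ih⟩)
          · exact Or.inl h2
          · exact Or.inr (Or.inr ⟨Reachable.refl _, h2⟩)
  · rintro (h | ⟨h1, h2⟩ | ⟨h1, h2⟩)
    · exact h.mono le_sup_left
    · exact (h1.mono le_sup_left).trans (hedge.trans (h2.mono le_sup_left))
    · exact (h1.mono le_sup_left).trans (hedge.symm.trans (h2.mono le_sup_left))

theorem deleteEdges_sup_edge (h : G.Adj a b) : G.deleteEdges {s(a, b)} ⊔ edge a b = G := by
  ext x y
  simp only [sup_adj, deleteEdges_adj, edge_adj, Set.mem_singleton_iff, Sym2.eq_iff]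
  constructor
  · rintro (h' | ⟨⟨rfl, rfl⟩ | ⟨rfl, rfl⟩, -⟩)
    exacts [h'.1, h, h.symm]
  · intro h'
    have := h'.ne
    tauto

theorem sup_edge_deleteEdges (h : ¬ G.Adj a b) : (G ⊔ edge a b).deleteEdges {s(a, b)} = G := by
  ext x y
  simp only [sup_adj, deleteEdges_adj, edge_adj, Set.mem_singleton_iff, Sym2.eq_iff]
  constructor
  · rintro ⟨h' | h', h''⟩
    exacts [h', absurd h'.1 h'']
  · intro h'
    refine ⟨Or.inl h', ?_⟩
    rintro (⟨rfl, rfl⟩ | ⟨rfl, rfl⟩)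
    exacts [h h', h h'.symm]

theorem IsAcyclic.not_reachable_deleteEdges (hG : G.IsAcyclic) (h : G.Adj a b) :
    ¬ (G.deleteEdges {s(a, b)}).Reachable a b :=
  isBridge_iff.1 (isAcyclic_iff_forall_adj_isBridge.1 hG h)

theorem reachable_deleteEdges_or (h : G.Adj a b) (hx : G.Reachable a x) :
    (G.deleteEdges {s(a, b)}).Reachable a x ∨ (G.deleteEdges {s(a, b)}).Reachable b x := by
  rw [← deleteEdges_sup_edge h, reachable_sup_edge_iff h.ne] at hx
  tauto

/-- In a forest, a node `x` connected to `a` lies on the far side of exactly one edge at `a`. -/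
theorem IsAcyclic.existsUnique_adj_reachable (hG : G.IsAcyclic) (hx : G.Reachable a x)
    (hne : x ≠ a) :
    ∃! k, G.Adj a k ∧ (G.deleteEdges {s(a, k)}).Reachable k x := by
  classical
  have key : ∀ k, G.Adj a k → ∀ p : G.Walk k x, a ∉ p.support →
      (G.deleteEdges {s(a, k)}).Reachable k x := fun k _ p hp =>
    reachable_deleteEdges_iff_exists_walk.2
      ⟨p, fun he => hp (p.fst_mem_support_of_mem_edges he)⟩
  obtain ⟨p, hp⟩ := hx.exists_isPath
  cases p with
  | nil => exact absurd rfl hne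
  | @cons _ k _ h p =>
    rw [Walk.cons_isPath_iff] at hp
    refine ⟨k, ⟨h, key k h p hp.2⟩, ?_⟩
    rintro l ⟨hl, hlx⟩
    by_contra hlk
    -- The rest of the path avoids `a`, so it survives the deletion of `al`; then `a` still reaches
    -- `l` through `k` and `x`, although `al` is a bridge.
    have hpl : s(a, l) ∉ p.edges := fun he => hp.2 (p.fst_mem_support_of_mem_edges he)
    have h1 : (G.deleteEdges {s(a, l)}).Reachable k x :=
      reachable_deleteEdges_iff_exists_walk.2 ⟨p, hpl⟩
    have h2 : (G.deleteEdges {s(a, l)}).Adj a k := by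
      rw [deleteEdges_adj]
      refine ⟨h, ?_⟩
      simp only [Set.mem_singleton_iff, Sym2.eq_iff]
      rintro (⟨-, h'⟩ | ⟨h', -⟩)
      exacts [hlk h'.symm, hl.ne h']
    exact hG.not_reachable_deleteEdges hl (h2.reachable.trans (h1.trans hlx.symm))

theorem prod_edgeFinset_sup_edge [DecidableEq V] [Fintype G.edgeSet]
    [Fintype (G ⊔ edge a b).edgeSet] {M : Type*} [CommMonoid M] (f : Sym2 V → M)
    (hn : ¬ G.Adj a b) (hab : a ≠ b) :
    ∏ e ∈ (G ⊔ edge a b).edgeFinset, f e = f s(a, b) * ∏ e ∈ G.edgeFinset, f e := by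
  rw [← Finset.prod_insert (a := s(a, b)) (s := G.edgeFinset) (by simpa using hn)]
  refine Finset.prod_congr ?_ fun _ _ => rfl
  ext e
  simp [edgeSet_edge_of_ne hab, or_comm]

end SimpleGraph

/-! ### Roots, and the moves between rooted forests. -/

namespace WeightedGraph

variable {V : Type*} {G : WeightedGraph V}

namespace RootedForest

/-- The root of the tree containing `i`. -/
def root (φ : G.RootedForest) (i : V) : V := (φ.existsUnique_root i).choose

theorem root_mem (φ : G.RootedForest) (i : V) : φ.root i ∈ φ.roots :=
  (φ.existsUnique_root i).choose_spec.1.1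

theorem reachable_root (φ : G.RootedForest) (i : V) : φ.graph.Reachable i (φ.root i) :=
  (φ.existsUnique_root i).choose_spec.1.2

theorem root_eq_of_mem (φ : G.RootedForest) {i r : V} (hr : r ∈ φ.roots)
    (h : φ.graph.Reachable i r) : φ.root i = r :=
  ((φ.existsUnique_root i).choose_spec.2 r ⟨hr, h⟩).symm

theorem root_eq_root (φ : G.RootedForest) {i j : V} (h : φ.graph.Reachable i j) :
    φ.root i = φ.root j :=
  φ.root_eq_of_mem (φ.root_mem j) (h.trans (φ.reachable_root j))

theorem root_eq_self_of_mem (φ : G.RootedForest) {r : V} (hr : r ∈ φ.roots) : φ.root r = r :=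
  φ.root_eq_of_mem hr (SimpleGraph.Reachable.refl r)

variable [DecidableEq V]

/-- Make `k` the root of its tree. -/
def reroot (φ : G.RootedForest) (k : V) : G.RootedForest where
  graph := φ.graph
  roots := insert k (φ.roots.erase (φ.root k))
  le := φ.le
  acyclic := φ.acyclic
  existsUnique_root i := by
    by_cases h : φ.graph.Reachable i k
    · refine ⟨k, ⟨Finset.mem_insert_self _ _, h⟩, ?_⟩
      rintro r ⟨hr, hir⟩
      rcases Finset.mem_insert.1 hr with rfl | hr
      · rfl
      · obtain ⟨hne, hr⟩ := Finset.mem_erase.1 hr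
        exact absurd (φ.root_eq_of_mem hr (h.symm.trans hir)).symm hne
    · refine ⟨φ.root i, ⟨Finset.mem_insert_of_mem (Finset.mem_erase.2 ⟨fun he => h ?_,
        φ.root_mem i⟩), φ.reachable_root i⟩, ?_⟩
      · exact (φ.reachable_root i).trans (he ▸ (φ.reachable_root k).symm)
      · rintro r ⟨hr, hir⟩
        rcases Finset.mem_insert.1 hr with rfl | hr
        · exact absurd hir h
        · exact (φ.root_eq_of_mem (Finset.mem_erase.1 hr).2 hir).symm

theorem root_reroot (φ : G.RootedForest) {i k : V} (h : φ.graph.Reachable i k) :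
    (φ.reroot k).root i = k :=
  (φ.reroot k).root_eq_of_mem (Finset.mem_insert_self _ _) h

theorem card_roots_reroot (φ : G.RootedForest) (k : V) :
    (φ.reroot k).roots.card = φ.roots.card := by
  -- This covers the case where `k` is already a root: it is then `φ.root k`, the node just erased.
  have hk : k ∉ φ.roots.erase (φ.root k) := fun h =>
    (Finset.mem_erase.1 h).1 (φ.root_eq_self_of_mem (Finset.mem_erase.1 h).2).symm
  rw [reroot, Finset.card_insert_of_notMem hk, Finset.card_erase_add_one (φ.root_mem k)]

theorem reroot_reroot_root (φ : G.RootedForest) (k : V) :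
    (φ.reroot k).reroot (φ.root k) = φ := by
  have h1 : (φ.reroot k).root (φ.root k) = k := φ.root_reroot (φ.reachable_root k).symm
  have hk : k ∉ φ.roots.erase (φ.root k) := fun h =>
    (Finset.mem_erase.1 h).1 (φ.root_eq_self_of_mem (Finset.mem_erase.1 h).2).symm
  refine RootedForest.ext rfl ?_
  change insert (φ.root k) ((insert k (φ.roots.erase (φ.root k))).erase
    ((φ.reroot k).root (φ.root k))) = φ.roots
  rw [h1, Finset.erase_insert hk, Finset.insert_erase (φ.root_mem k)]

/-- Join the tree rooted at `a` to the tree of `b` by the edge `ab`, forgetting the root `a`. -/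
def join (φ : G.RootedForest) (a b : V) (hW : 0 < G.W a b) (ha : a ∈ φ.roots)
    (hab : ¬ φ.graph.Reachable a b) : G.RootedForest where
  graph := φ.graph ⊔ SimpleGraph.edge a b
  roots := φ.roots.erase a
  le := by
    refine sup_le φ.le ((SimpleGraph.edge_le_iff _).2 (Or.inr ⟨?_, hW⟩))
    rintro rfl
    exact hab (SimpleGraph.Reachable.refl a)
  acyclic := φ.acyclic.sup_edge_of_not_reachable hab
  existsUnique_root i := by
    have hne : a ≠ b := by
      rintro rfl
      exact hab (SimpleGraph.Reachable.refl a)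
    have hrb : φ.root b ≠ a := fun h => hab (h ▸ (φ.reachable_root b).symm)
    simp only [SimpleGraph.reachable_sup_edge_iff hne, Finset.mem_erase]
    by_cases h : φ.graph.Reachable i a
    · refine ⟨φ.root b, ⟨⟨hrb, φ.root_mem b⟩, Or.inr (Or.inl ⟨h, φ.reachable_root b⟩)⟩, ?_⟩
      rintro r ⟨⟨hra, hr⟩, h' | ⟨-, h'⟩ | ⟨h', -⟩⟩
      · exact absurd ((φ.root_eq_of_mem hr (h.symm.trans h')).symm.trans
          (φ.root_eq_self_of_mem ha)) hra
      · exact (φ.root_eq_of_mem hr h').symm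
      · exact absurd (h.symm.trans h') hab
    · refine ⟨φ.root i, ⟨⟨fun he => h (he ▸ φ.reachable_root i), φ.root_mem i⟩,
        Or.inl (φ.reachable_root i)⟩, ?_⟩
      rintro r ⟨⟨hra, hr⟩, h' | ⟨h', -⟩ | ⟨-, h'⟩⟩
      · exact (φ.root_eq_of_mem hr h').symm
      · exact absurd h' h
      · exact absurd ((φ.root_eq_of_mem hr h').symm.trans (φ.root_eq_self_of_mem ha)) hra

/-- Delete the edge `ab` when `a` lies below `b`, making `a` a root. -/
def cut (ψ : G.RootedForest) (a b : V) (hab : ψ.graph.Adj a b)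
    (hb : (ψ.graph.deleteEdges {s(a, b)}).Reachable b (ψ.root b)) : G.RootedForest where
  graph := ψ.graph.deleteEdges {s(a, b)}
  roots := insert a ψ.roots
  le := (SimpleGraph.deleteEdges_le _).trans ψ.le
  acyclic := ψ.acyclic.anti (SimpleGraph.deleteEdges_le _)
  existsUnique_root i := by
    have hbridge := ψ.acyclic.not_reachable_deleteEdges hab
    have hle : ψ.graph.deleteEdges {s(a, b)} ≤ ψ.graph := SimpleGraph.deleteEdges_le _
    -- By `hb` the only root of the old tree lies on the side of `b`, so the side of `a` has none
    -- until `a` is inserted.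
    have hra : ∀ r ∈ ψ.roots, ¬ (ψ.graph.deleteEdges {s(a, b)}).Reachable a r := by
      intro r hr har
      have : ψ.root b = r := ψ.root_eq_of_mem hr (hab.symm.reachable.trans (har.mono hle))
      exact hbridge (har.trans (this ▸ hb.symm))
    by_cases h : (ψ.graph.deleteEdges {s(a, b)}).Reachable i a
    · refine ⟨a, ⟨Finset.mem_insert_self _ _, h⟩, ?_⟩
      rintro r ⟨hr, hir⟩
      rcases Finset.mem_insert.1 hr with rfl | hr
      · rfl
      · exact absurd (h.symm.trans hir) (hra r hr)
    · refine ⟨ψ.root i, ⟨Finset.mem_insert_of_mem (ψ.root_mem i), ?_⟩, ?_⟩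
      · have hi := ψ.reachable_root i
        rw [← SimpleGraph.deleteEdges_sup_edge hab,
          SimpleGraph.reachable_sup_edge_iff hab.ne] at hi
        rcases hi with hi | ⟨hi, -⟩ | ⟨-, hi⟩
        · exact hi
        · exact absurd hi h
        · exact absurd hi (hra _ (ψ.root_mem i))
      · rintro r ⟨hr, hir⟩
        rcases Finset.mem_insert.1 hr with rfl | hr
        · exact absurd hir h
        · exact (ψ.root_eq_of_mem hr (hir.mono hle)).symm

end RootedForest

end WeightedGraph

/-! ### Weights of forests and weight-preserving bijections. -/

namespace WeightedGraph

variable {V : Type*} {G : WeightedGraph V}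

instance [Finite V] : Fintype G.RootedForest := Fintype.ofFinite _

namespace RootedForest

variable [Fintype V]

theorem weight_nonneg (φ : G.RootedForest) {q : ℝ} (hq : 0 < q) : 0 ≤ φ.weight q := by
  refine mul_nonneg (pow_nonneg hq.le _) (Finset.prod_nonneg fun e _ => ?_)
  induction e with
  | _ i j => exact G.nonneg i j

theorem mem_tree {φ : G.RootedForest} {i j : V} : j ∈ φ.tree i ↔ φ.graph.Reachable i j := by
  simp [tree]

theorem self_mem_tree (φ : G.RootedForest) (i : V) : i ∈ φ.tree i :=
  mem_tree.2 (SimpleGraph.Reachable.refl i)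

theorem card_tree_ne_zero (φ : G.RootedForest) (i : V) : ((φ.tree i).card : ℝ) ≠ 0 :=
  Nat.cast_ne_zero.2 (Finset.card_ne_zero_of_mem (φ.self_mem_tree i))

theorem tree_eq_tree (φ : G.RootedForest) {i j : V} (h : φ.graph.Reachable i j) :
    φ.tree i = φ.tree j := by
  ext k
  rw [mem_tree, mem_tree]
  exact ⟨h.symm.trans, h.trans⟩

variable [DecidableEq V]

theorem weight_reroot (φ : G.RootedForest) (k : V) (q : ℝ) :
    (φ.reroot k).weight q = φ.weight q := by
  rw [weight, card_roots_reroot]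
  rfl

/-- One root is lost and the edge `ab` is gained; the factor `q` on the left makes up for the lost
root. -/
theorem mul_weight_join (φ : G.RootedForest) {a b : V} (hW : 0 < G.W a b) (ha : a ∈ φ.roots)
    (hab : ¬ φ.graph.Reachable a b) (q : ℝ) :
    q * (φ.join a b hW ha hab).weight q = G.W a b * φ.weight q := by
  classical
  have hne : a ≠ b := by
    rintro rfl
    exact hab (SimpleGraph.Reachable.refl a)
  have hprod := SimpleGraph.prod_edgeFinset_sup_edge G.edgeWeight
    (fun h : φ.graph.Adj a b => hab h.reachable) hne
  have hcard : φ.roots.card = (φ.roots.erase a).card + 1 :=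
    (Finset.card_erase_add_one ha).symm
  have hw : G.edgeWeight s(a, b) = G.W a b := rfl
  rw [hw] at hprod
  have h1 : (φ.join a b hW ha hab).weight q = q ^ (φ.roots.erase a).card *
      (G.W a b * ∏ e ∈ φ.graph.edgeFinset, G.edgeWeight e) := by
    rw [← hprod, weight]
    refine congrArg₂ (· * ·) rfl (Finset.prod_congr ?_ fun _ _ => rfl)
    ext e
    rw [SimpleGraph.mem_edgeFinset, SimpleGraph.mem_edgeFinset]
    rfl
  have h2 : φ.weight q = q ^ φ.roots.card * ∏ e ∈ φ.graph.edgeFinset, G.edgeWeight e := rfl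
  rw [h1, h2, hcard]
  ring

open scoped Classical in
/-- Moving a root inside its tree changes neither the weight nor the graph. -/
theorem sum_weight_reroot (q : ℝ) (f : G.RootedForest → ℝ)
    (hf : ∀ φ k, f (φ.reroot k) = f φ) (i j k : V) :
    (∑ φ : G.RootedForest with φ.root i = j ∧ φ.graph.Reachable j k, φ.weight q * f φ) =
      ∑ φ : G.RootedForest with φ.root i = k ∧ φ.graph.Reachable j k, φ.weight q * f φ := by
  refine Finset.sum_bij' (fun φ _ => φ.reroot k) (fun φ _ => φ.reroot j) ?_ ?_ ?_ ?_ ?_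
  · intro φ hφ
    simp only [Finset.mem_filter, Finset.mem_univ, true_and] at hφ ⊢
    obtain ⟨rfl, h⟩ := hφ
    exact ⟨φ.root_reroot ((φ.reachable_root i).trans h), h⟩
  · intro φ hφ
    simp only [Finset.mem_filter, Finset.mem_univ, true_and] at hφ ⊢
    obtain ⟨rfl, h⟩ := hφ
    exact ⟨φ.root_reroot ((φ.reachable_root i).trans h.symm), h⟩
  · intro φ hφ
    simp only [Finset.mem_filter, Finset.mem_univ, true_and] at hφ
    obtain ⟨rfl, h⟩ := hφ
    have : φ.root k = φ.root i :=
      φ.root_eq_root (h.symm.trans (φ.reachable_root i).symm)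
    rw [← this, reroot_reroot_root]
  · intro φ hφ
    simp only [Finset.mem_filter, Finset.mem_univ, true_and] at hφ
    obtain ⟨rfl, h⟩ := hφ
    have : φ.root j = φ.root i :=
      φ.root_eq_root (h.trans (φ.reachable_root i).symm)
    rw [← this, reroot_reroot_root]
  · intro φ _
    rw [weight_reroot, hf]

open scoped Classical in
/-- Summing over the forests in which the root `a` of `i` can be joined to the tree of `b` amounts
to summing over the forests that contain the edge `ab`, directed towards `b`. -/
theorem mul_sum_weight_join (q : ℝ) (i a b : V) :
    G.W a b * (∑ φ : G.RootedForest with φ.root i = a ∧ ¬ φ.graph.Reachable a b, φ.weight q) =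
      q * ∑ ψ : G.RootedForest with ψ.graph.Adj a b ∧
        (ψ.graph.deleteEdges {s(a, b)}).Reachable b (ψ.root b) ∧
        (ψ.graph.deleteEdges {s(a, b)}).Reachable i a, ψ.weight q := by
  -- When `W a b = 0` there is no edge to join along, but no forest contains `ab` either, and both
  -- sides vanish.
  rcases (G.nonneg a b).eq_or_lt with hW | hW
  · rw [Finset.sum_eq_zero (s := Finset.univ.filter fun ψ : G.RootedForest => ψ.graph.Adj a b ∧ _)]
    · rw [← hW, zero_mul, mul_zero]
    · intro ψ hψ
      have h := (ψ.le (Finset.mem_filter.1 hψ).2.1).2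
      exact absurd hW h.ne
  rw [Finset.mul_sum, Finset.mul_sum]
  have ha : ∀ φ ∈ Finset.univ.filter fun φ : G.RootedForest =>
      φ.root i = a ∧ ¬ φ.graph.Reachable a b, a ∈ φ.roots ∧ ¬ φ.graph.Reachable a b := by
    intro φ hφ
    have h := (Finset.mem_filter.1 hφ).2
    exact ⟨h.1 ▸ φ.root_mem i, h.2⟩
  refine Finset.sum_bij' (fun φ hφ => φ.join a b hW (ha φ hφ).1 (ha φ hφ).2)
    (fun ψ hψ => ψ.cut a b (Finset.mem_filter.1 hψ).2.1 (Finset.mem_filter.1 hψ).2.2.1)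
    ?_ ?_ ?_ ?_ ?_
  · intro φ hφ
    obtain ⟨har, hab⟩ := ha φ hφ
    have hia : φ.root i = a := (Finset.mem_filter.1 hφ).2.1
    have hne : a ≠ b := by
      rintro rfl
      exact hab (SimpleGraph.Reachable.refl a)
    have hgr : (φ.join a b hW har hab).graph.deleteEdges {s(a, b)} = φ.graph :=
      SimpleGraph.sup_edge_deleteEdges fun h => hab h.reachable
    have hroot : (φ.join a b hW har hab).root b = φ.root b := by
      refine root_eq_of_mem _ (Finset.mem_erase.2 ⟨fun h => ?_, φ.root_mem b⟩)
        ((φ.reachable_root b).mono le_sup_left)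
      exact hab (h ▸ (φ.reachable_root b).symm)
    refine Finset.mem_filter.2 ⟨Finset.mem_univ _, ?_, ?_, ?_⟩
    · exact Or.inr ((SimpleGraph.edge_adj ..).2 ⟨Or.inl ⟨rfl, rfl⟩, hne⟩)
    · rw [hgr, hroot]
      exact φ.reachable_root b
    · rw [hgr, ← hia]
      exact φ.reachable_root i
  · intro ψ hψ
    obtain ⟨-, hab, hb, hi⟩ := Finset.mem_filter.1 hψ
    refine Finset.mem_filter.2 ⟨Finset.mem_univ _, ?_, ?_⟩
    · exact root_eq_of_mem _ (Finset.mem_insert_self _ _) hi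
    · exact ψ.acyclic.not_reachable_deleteEdges hab
  · intro φ hφ
    obtain ⟨har, hab⟩ := ha φ hφ
    refine RootedForest.ext ?_ ?_
    · exact SimpleGraph.sup_edge_deleteEdges fun h => hab h.reachable
    · exact Finset.insert_erase har
  · intro ψ hψ
    obtain ⟨-, hab, hb, hi⟩ := Finset.mem_filter.1 hψ
    refine RootedForest.ext ?_ ?_
    · exact SimpleGraph.deleteEdges_sup_edge hab
    · refine Finset.erase_insert fun har => ?_
      have h : ψ.root b = a := ψ.root_eq_of_mem har hab.symm.reachable
      rw [h] at hb
      exact ψ.acyclic.not_reachable_deleteEdges hab hb.symm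
  · intro φ hφ
    exact (φ.mul_weight_join hW (ha φ hφ).1 (ha φ hφ).2 q).symm

open scoped Classical in
/-- Of the edges at `j`, exactly one leads towards each other node of the tree of `j`. -/
theorem sum_adj_reachable (ψ : G.RootedForest) {j x : V} (h : ψ.graph.Reachable j x) :
    (∑ k, if ψ.graph.Adj j k ∧ (ψ.graph.deleteEdges {s(j, k)}).Reachable k x then (1 : ℝ) else 0) =
      1 - if x = j then 1 else 0 := by
  split_ifs with hx
  · rw [sub_self]
    refine Finset.sum_eq_zero fun k _ => if_neg ?_
    rintro ⟨hk, hr⟩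
    rw [hx] at hr
    exact ψ.acyclic.not_reachable_deleteEdges hk hr.symm
  · obtain ⟨k, hk, huniq⟩ := ψ.acyclic.existsUnique_adj_reachable h hx
    rw [Finset.sum_eq_single k, if_pos hk, sub_zero]
    · exact fun l _ hl => if_neg fun h' => hl (huniq l h')
    · exact fun h' => absurd (Finset.mem_univ k) h'

open scoped Classical in
-- Kirchhoff's law for the path from `i` to its root: the two indicators say that this path uses the
-- edge from `j` to `k`, respectively from `k` to `j`.
theorem sum_edge_directions (ψ : G.RootedForest) (i j : V) :
    (∑ k, ((if ψ.graph.Adj j k ∧ (ψ.graph.deleteEdges {s(j, k)}).Reachable k (ψ.root k) ∧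
          (ψ.graph.deleteEdges {s(j, k)}).Reachable i j then (1 : ℝ) else 0) -
        if ψ.graph.Adj k j ∧ (ψ.graph.deleteEdges {s(k, j)}).Reachable j (ψ.root j) ∧
          (ψ.graph.deleteEdges {s(k, j)}).Reachable i k then 1 else 0)) =
      (if i = j then 1 else 0) - if ψ.root i = j then 1 else 0 := by
  by_cases h : ψ.graph.Reachable i j
  · have hi := ψ.sum_adj_reachable h.symm
    have hr := ψ.sum_adj_reachable (ψ.reachable_root j)
    rw [ψ.root_eq_root h]
    have : ((if i = j then 1 else 0) - if ψ.root j = j then 1 else 0 : ℝ) =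
        (1 - if ψ.root j = j then 1 else 0) - (1 - if i = j then 1 else 0) := by ring
    rw [this, ← hi, ← hr, ← Finset.sum_sub_distrib]
    refine Finset.sum_congr rfl fun k _ => ?_
    by_cases hk : ψ.graph.Adj j k
    · have hbr := ψ.acyclic.not_reachable_deleteEdges hk
      have hkj : s(k, j) = s(j, k) := Sym2.eq_swap
      have hroot : ψ.root k = ψ.root j := ψ.root_eq_root hk.symm.reachable
      rw [hkj, hroot]
      -- Deleting the bridge `jk` puts each node of the tree on exactly one side. If `A` and `B`
      -- indicate that `i` and the root lie on the side of `k`, the summand is `B (1 - A) - A (1 -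
      -- B) = B - A`.
      have key : ∀ x, ψ.graph.Reachable j x →
          ((ψ.graph.deleteEdges {s(j, k)}).Reachable j x ↔
            ¬ (ψ.graph.deleteEdges {s(j, k)}).Reachable k x) := fun x hx =>
        ⟨fun h1 h2 => hbr (h1.trans h2.symm),
          fun h1 => (SimpleGraph.reachable_deleteEdges_or hk hx).resolve_right h1⟩
      have k1 := SimpleGraph.reachable_comm.trans (key i h.symm)
      have k2 := key _ (ψ.reachable_root j)
      have k3 := SimpleGraph.reachable_comm (G := ψ.graph.deleteEdges {s(j, k)}) (u := i) (v := k)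
      simp only [k1, k2, k3, hk, hk.symm, true_and]
      by_cases c1 : (ψ.graph.deleteEdges {s(j, k)}).Reachable k i <;>
      by_cases c2 : (ψ.graph.deleteEdges {s(j, k)}).Reachable k (ψ.root j) <;>
      simp [c1, c2]
    · have hk' : ¬ ψ.graph.Adj k j := fun h' => hk h'.symm
      simp [hk, hk']
  · have hij : i ≠ j := fun h' => h (h' ▸ SimpleGraph.Reachable.refl _)
    have hr : ψ.root i ≠ j := fun h' => h (h' ▸ ψ.reachable_root i)
    rw [if_neg hij, if_neg hr, sub_zero]
    refine Finset.sum_eq_zero fun k _ => ?_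
    rw [if_neg, if_neg, sub_zero]
    · rintro ⟨hk, -, hik⟩
      exact h ((hik.mono (SimpleGraph.deleteEdges_le _)).trans hk.reachable)
    · rintro ⟨hk, -, hik⟩
      exact h (hik.mono (SimpleGraph.deleteEdges_le _))

end RootedForest

/-! ### The matrix of root weights and its linear equation. -/

variable (G) [Fintype V]

/-- The total weight of all rooted forests. -/
def partitionFunction (q : ℝ) : ℝ := ∑ φ : G.RootedForest, φ.weight q

variable [DecidableEq V]

/-- The total weight of the rooted forests in which the root of `i` is `j`. -/
def rootWeight (q : ℝ) : Matrix V V ℝ := fun i j =>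
  ∑ φ : G.RootedForest with φ.root i = j, φ.weight q

open scoped Classical in
-- Forests with `j` and `k` in one tree cancel by rerooting; those left are the ones that can be
-- joined along `jk`.
theorem rootWeight_sub_rootWeight (q : ℝ) (i j k : V) :
    G.rootWeight q i j - G.rootWeight q i k =
      (∑ φ : G.RootedForest with φ.root i = j ∧ ¬ φ.graph.Reachable j k, φ.weight q) -
      ∑ φ : G.RootedForest with φ.root i = k ∧ ¬ φ.graph.Reachable k j, φ.weight q := by
  have h := RootedForest.sum_weight_reroot (G := G) q (fun _ => 1) (fun _ _ => rfl) i j k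
  simp only [mul_one] at h
  simp only [rootWeight, SimpleGraph.reachable_comm (u := k) (v := j)]
  rw [← Finset.sum_filter_add_sum_filter_not
      (Finset.univ.filter fun φ : G.RootedForest => φ.root i = j)
      (fun φ => φ.graph.Reachable j k),
    ← Finset.sum_filter_add_sum_filter_not
      (Finset.univ.filter fun φ : G.RootedForest => φ.root i = k)
      (fun φ => φ.graph.Reachable j k)]
  simp only [Finset.filter_filter]
  rw [h]
  ring

/-- This is the entry `(i, j)` of `R (q I + L) = q Z I`, with the diagonal part `q R i j` moved to
the right. -/
theorem sum_W_mul_rootWeight_sub (q : ℝ) (i j : V) :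
    ∑ k, G.W j k * (G.rootWeight q i j - G.rootWeight q i k) =
      q * (if i = j then G.partitionFunction q else 0) - q * G.rootWeight q i j := by
  classical
  have h1 : ∀ k, G.W j k * (G.rootWeight q i j - G.rootWeight q i k) =
      q * ∑ ψ : G.RootedForest, ψ.weight q *
        ((if ψ.graph.Adj j k ∧ (ψ.graph.deleteEdges {s(j, k)}).Reachable k (ψ.root k) ∧
          (ψ.graph.deleteEdges {s(j, k)}).Reachable i j then (1 : ℝ) else 0) -
        if ψ.graph.Adj k j ∧ (ψ.graph.deleteEdges {s(k, j)}).Reachable j (ψ.root j) ∧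
          (ψ.graph.deleteEdges {s(k, j)}).Reachable i k then 1 else 0) := by
    intro k
    have hA := RootedForest.mul_sum_weight_join (G := G) q i j k
    have hB := RootedForest.mul_sum_weight_join (G := G) q i k j
    rw [G.symm.apply j k] at hB
    rw [rootWeight_sub_rootWeight, mul_sub, hA, hB, ← mul_sub, Finset.sum_filter,
      Finset.sum_filter, ← Finset.sum_sub_distrib]
    congr 1
    refine Finset.sum_congr rfl fun ψ _ => ?_
    rw [mul_sub, mul_ite, mul_ite, mul_one, mul_zero]
  rw [Finset.sum_congr rfl fun k _ => h1 k, ← Finset.mul_sum, Finset.sum_comm, ← mul_sub]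
  congr 1
  simp only [← Finset.mul_sum, RootedForest.sum_edge_directions]
  simp only [mul_sub, Finset.sum_sub_distrib, mul_ite, mul_one, mul_zero]
  rw [rootWeight, Finset.sum_filter, partitionFunction]
  split_ifs <;> simp

theorem rootWeight_mul_smul_one_add_laplacian (q : ℝ) :
    G.rootWeight q * (q • (1 : Matrix V V ℝ) + G.laplacian) =
      (q * G.partitionFunction q) • (1 : Matrix V V ℝ) := by
  ext i j
  have h := G.sum_W_mul_rootWeight_sub q i j
  simp only [mul_sub, Finset.sum_sub_distrib] at h
  have hc : ∑ k, G.rootWeight q i k * G.W k j = ∑ k, G.W j k * G.rootWeight q i k :=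
    Finset.sum_congr rfl fun k _ => by rw [G.symm.apply j k, mul_comm]
  rw [mul_add, Matrix.add_apply, laplacian, mul_sub, Matrix.sub_apply, Matrix.mul_diagonal,
    Matrix.mul_apply (N := G.W), hc, Matrix.mul_smul, mul_one, Matrix.smul_apply,
    Matrix.smul_apply, Matrix.one_apply, smul_eq_mul, smul_eq_mul, mul_comm (G.rootWeight q i j),
    Finset.sum_mul, h]
  split_ifs <;> ring

/-- Given its tree, the root of `i` is uniform on it, so it equals a given node `j` of the tree with
probability `1 / |T(i)|`. -/
theorem sum_weight_div_card_tree (q : ℝ) (i j : V) :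
    (∑ φ : G.RootedForest, φ.weight q * if j ∈ φ.tree i then 1 / ((φ.tree i).card : ℝ) else 0) =
      G.rootWeight q i j := by
  classical
  calc (∑ φ : G.RootedForest,
        φ.weight q * if j ∈ φ.tree i then 1 / ((φ.tree i).card : ℝ) else 0)
      -- Here `k` is forced to be the root of `i`. After rerooting at `j` it ranges freely over the
      -- tree, and the `|T(i)|` equal terms cancel the denominator.
      = ∑ k, ∑ φ : G.RootedForest with φ.root i = k ∧ φ.graph.Reachable j k,
          φ.weight q * (1 / ((φ.tree i).card : ℝ)) := by
        simp only [Finset.sum_filter]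
        rw [Finset.sum_comm]
        refine Finset.sum_congr rfl fun φ _ => ?_
        rw [Finset.sum_eq_single (φ.root i)]
        · rw [mul_ite, mul_zero]
          refine if_congr ?_ rfl rfl
          rw [RootedForest.mem_tree]
          have := φ.reachable_root i
          exact ⟨fun h => ⟨rfl, h.symm.trans this⟩, fun h => this.trans h.2.symm⟩
        · exact fun k _ hk => if_neg fun h => hk h.1.symm
        · exact fun h => absurd (Finset.mem_univ _) h
    _ = ∑ k, ∑ φ : G.RootedForest with φ.root i = j ∧ φ.graph.Reachable j k,
          φ.weight q * (1 / ((φ.tree i).card : ℝ)) :=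
        Finset.sum_congr rfl fun k _ => (RootedForest.sum_weight_reroot q
          (fun φ => 1 / ((φ.tree i).card : ℝ)) (fun _ _ => rfl) i j k).symm
    _ = G.rootWeight q i j := by
        simp only [Finset.sum_filter, rootWeight]
        rw [Finset.sum_comm]
        refine Finset.sum_congr rfl fun φ _ => ?_
        split_ifs with h
        · have hij : φ.graph.Reachable i j := h ▸ φ.reachable_root i
          have hz := φ.card_tree_ne_zero i
          simp only [h, true_and]
          rw [← Finset.sum_filter, Finset.sum_const, nsmul_eq_mul]
          have : ((Finset.univ.filter fun k => φ.graph.Reachable j k).card : ℝ) =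
              (φ.tree i).card := by
            rw [φ.tree_eq_tree hij]
            congr 2
            ext k
            simp [RootedForest.mem_tree]
          rw [this]
          field_simp
        · exact Finset.sum_eq_zero fun k _ => if_neg fun h' => h h'.1

end WeightedGraph

namespace WeightedGraph

variable {V : Type*} [Fintype V]

theorem norm_toLp_sq (v : V → ℝ) : ‖WithLp.toLp 2 v‖ ^ 2 = v ⬝ᵥ v := by
  rw [EuclideanSpace.real_norm_sq_eq, dotProduct]
  exact Finset.sum_congr rfl fun i _ => sq (v i)

theorem partitionFunction_pos {G : WeightedGraph V} {q : ℝ} (hq : 0 < q) : 0 < G.partitionFunction q := by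
  refine Finset.sum_pos' (fun φ _ => φ.weight_nonneg hq) ⟨G.trivialForest, Finset.mem_univ _, ?_⟩
  rw [trivialForest_weight]
  exact pow_pos hq _

/-! ### The smoothing problem. -/

section QuadraticForm

variable [DecidableEq V] (G : WeightedGraph V)

theorem laplacian_isSymm : G.laplacian.IsSymm :=
  (Matrix.isSymm_diagonal _).sub G.symm

theorem dotProduct_laplacian_mulVec (z : V → ℝ) :
    z ⬝ᵥ G.laplacian *ᵥ z = 1 / 2 * ∑ i, ∑ j, G.W i j * (z i - z j) ^ 2 := by
  have h1 : ∑ i, ∑ j, G.W i j * z j ^ 2 = ∑ i, ∑ j, G.W i j * z i ^ 2 := by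
    rw [Finset.sum_comm]
    exact Finset.sum_congr rfl fun i _ => Finset.sum_congr rfl fun j _ => by
      rw [G.symm.apply i j]
  have h2 : ∑ i, ∑ j, G.W i j * (z i - z j) ^ 2 = (∑ i, ∑ j, G.W i j * z i ^ 2) +
      (∑ i, ∑ j, G.W i j * z j ^ 2) - 2 * ∑ i, ∑ j, z i * (G.W i j * z j) := by
    simp only [Finset.mul_sum, ← Finset.sum_add_distrib, ← Finset.sum_sub_distrib]
    exact Finset.sum_congr rfl fun i _ => Finset.sum_congr rfl fun j _ => by ring
  have h3 : z ⬝ᵥ G.laplacian *ᵥ z =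
      (∑ i, ∑ j, G.W i j * z i ^ 2) - ∑ i, ∑ j, z i * (G.W i j * z j) := by
    rw [laplacian, Matrix.sub_mulVec, dotProduct_sub]
    simp only [dotProduct, Matrix.mulVec_diagonal]
    simp only [Matrix.mulVec, dotProduct, Finset.mul_sum, Finset.sum_mul]
    congr 1
    exact Finset.sum_congr rfl fun i _ => Finset.sum_congr rfl fun j _ => by ring
  rw [h3, h2, h1]
  ring

theorem dotProduct_laplacian_mulVec_nonneg (z : V → ℝ) : 0 ≤ z ⬝ᵥ G.laplacian *ᵥ z := by
  rw [dotProduct_laplacian_mulVec]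
  exact mul_nonneg (by norm_num) (Finset.sum_nonneg fun i _ => Finset.sum_nonneg fun j _ =>
    mul_nonneg (G.nonneg i j) (sq_nonneg _))

variable {G} {q : ℝ}

theorem isUnit_smul_one_add_laplacian (hq : 0 < q) :
    IsUnit (q • (1 : Matrix V V ℝ) + G.laplacian) := by
  have hne : q * G.partitionFunction q ≠ 0 := (mul_pos hq (partitionFunction_pos hq)).ne'
  refine IsUnit.of_mul_eq_one_right ((q * G.partitionFunction q)⁻¹ • G.rootWeight q) ?_
  rw [Matrix.smul_mul, rootWeight_mul_smul_one_add_laplacian, smul_smul, inv_mul_cancel₀ hne,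
    one_smul]

theorem rootWeight_eq_smul_smoother (hq : 0 < q) :
    G.rootWeight q = G.partitionFunction q • G.smoother q := by
  have hdet := (Matrix.isUnit_iff_isUnit_det _).1 (isUnit_smul_one_add_laplacian (G := G) hq)
  have h := congrArg (· * (q • (1 : Matrix V V ℝ) + G.laplacian)⁻¹)
    (G.rootWeight_mul_smul_one_add_laplacian q)
  simp only [Matrix.mul_assoc, Matrix.mul_nonsing_inv _ hdet, Matrix.mul_one, Matrix.smul_mul,
    Matrix.one_mul] at h
  rw [h, smoother, smul_smul, mul_comm]

theorem smoother_isSymm : (G.smoother q).IsSymm := by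
  have h : (q • (1 : Matrix V V ℝ) + G.laplacian).IsSymm :=
    (Matrix.isSymm_one.smul q).add G.laplacian_isSymm
  rw [smoother, Matrix.IsSymm, Matrix.transpose_smul, Matrix.transpose_nonsing_inv, h.eq]

/-- The stationarity condition of the objective at `K y`. -/
theorem laplacian_mulVec_smoother_mulVec (hq : 0 < q) (y : V → ℝ) :
    G.laplacian *ᵥ G.smoother q *ᵥ y = q • (y - G.smoother q *ᵥ y) := by
  have hdet := (Matrix.isUnit_iff_isUnit_det _).1 (isUnit_smul_one_add_laplacian (G := G) hq)
  have h : (q • (1 : Matrix V V ℝ) + G.laplacian) *ᵥ G.smoother q *ᵥ y = q • y := by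
    rw [Matrix.mulVec_mulVec, smoother, Matrix.mul_smul, Matrix.mul_nonsing_inv _ hdet,
      Matrix.smul_mulVec, Matrix.one_mulVec]
  rw [Matrix.add_mulVec, Matrix.smul_mulVec, Matrix.one_mulVec] at h
  rw [smul_sub, ← h, add_sub_cancel_left]

/-- The terms linear in `h` cancel by stationarity and the symmetry of `L`. -/
theorem objective_smoother_mulVec_add (hq : 0 < q) (y h : V → ℝ) :
    G.objective q y (G.smoother q *ᵥ y + h) =
      G.objective q y (G.smoother q *ᵥ y) + (q * (h ⬝ᵥ h) + h ⬝ᵥ G.laplacian *ᵥ h) := by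
  have hL := laplacian_mulVec_smoother_mulVec (G := G) hq y
  have hsymm : (G.smoother q *ᵥ y) ⬝ᵥ G.laplacian *ᵥ h =
      h ⬝ᵥ G.laplacian *ᵥ G.smoother q *ᵥ y := by
    rw [Matrix.dotProduct_mulVec, ← Matrix.mulVec_transpose, G.laplacian_isSymm.eq, dotProduct_comm]
  simp only [objective, norm_toLp_sq, Matrix.mulVec_add, dotProduct_add, add_dotProduct,
    hsymm, hL, dotProduct_smul, dotProduct_sub, sub_dotProduct, smul_eq_mul]
  rw [dotProduct_comm y h, dotProduct_comm (G.smoother q *ᵥ y) h]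
  ring

theorem objective_smoother_mulVec_lt (hq : 0 < q) (y : V → ℝ) {z : V → ℝ}
    (hz : z ≠ G.smoother q *ᵥ y) :
    G.objective q y (G.smoother q *ᵥ y) < G.objective q y z := by
  have h := objective_smoother_mulVec_add (G := G) hq y (z - G.smoother q *ᵥ y)
  rw [add_sub_cancel] at h
  have hne : z - G.smoother q *ᵥ y ≠ 0 := sub_ne_zero.2 hz
  have h1 : 0 < (z - G.smoother q *ᵥ y) ⬝ᵥ (z - G.smoother q *ᵥ y) := by
    rw [← norm_toLp_sq]
    exact pow_pos (norm_pos_iff.2 fun h' => hne ((WithLp.toLp_eq_zero 2).1 h')) 2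
  have h2 := G.dotProduct_laplacian_mulVec_nonneg (z - G.smoother q *ᵥ y)
  rw [h]
  have := mul_pos hq h1
  linarith

end QuadraticForm

/-! ### Tree averaging as a projection. -/

namespace RootedForest

variable {G : WeightedGraph V}

theorem treeAverage_eq_sum (φ : G.RootedForest) (y : V → ℝ) (i : V) [DecidableEq V] :
    φ.treeAverage y i =
      ∑ j, (if j ∈ φ.tree i then 1 / ((φ.tree i).card : ℝ) else 0) * y j := by
  simp [treeAverage, Finset.mul_sum, ite_mul]

theorem treeAverage_eq_treeAverage (φ : G.RootedForest) (y : V → ℝ) {i j : V}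
    (h : j ∈ φ.tree i) : φ.treeAverage y i = φ.treeAverage y j := by
  rw [treeAverage, treeAverage, φ.tree_eq_tree (mem_tree.1 h)]

/-- Averaging over the trees is an orthogonal projection. -/
theorem sum_treeAverage_sq (φ : G.RootedForest) (y : V → ℝ) :
    ∑ i, φ.treeAverage y i ^ 2 = ∑ i, y i * φ.treeAverage y i := by
  classical
  have hmem : ∀ i j, i ∈ φ.tree j ↔ j ∈ φ.tree i := fun i j => by
    rw [mem_tree, mem_tree, SimpleGraph.reachable_comm]
  calc ∑ i, φ.treeAverage y i ^ 2
      = ∑ i, ∑ j, if j ∈ φ.tree i then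
          1 / ((φ.tree j).card : ℝ) * (y j * φ.treeAverage y j) else 0 := by
        -- Within a tree `i` may be replaced by `j` in both the tree and the average. The summand
        -- then depends on `i` only through membership, so summing over `i` first yields the factor
        -- `|T(j)|`.
        refine Finset.sum_congr rfl fun i _ => ?_
        rw [sq]
        nth_rw 1 [φ.treeAverage_eq_sum y i]
        rw [Finset.sum_mul]
        refine Finset.sum_congr rfl fun j _ => ?_
        split_ifs with h
        · rw [φ.treeAverage_eq_treeAverage y h, φ.tree_eq_tree (mem_tree.1 h)]
          ring
        · ring
    _ = ∑ j, ∑ i, if i ∈ φ.tree j then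
          1 / ((φ.tree j).card : ℝ) * (y j * φ.treeAverage y j) else 0 := by
        rw [Finset.sum_comm]
        simp only [hmem]
    _ = ∑ j, y j * φ.treeAverage y j := by
        refine Finset.sum_congr rfl fun j _ => ?_
        have := φ.card_tree_ne_zero j
        rw [Finset.sum_ite_mem, Finset.univ_inter, Finset.sum_const, nsmul_eq_mul]
        field_simp

end RootedForest

/-! ### Moments under the forest law. -/

section Law

variable {G : WeightedGraph V} {q : ℝ}

instance : DiscreteMeasurableSpace G.RootedForest := ⟨fun _ => trivial⟩

theorem toReal_forestLaw (hq : 0 < q) (φ : G.RootedForest) :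
    (G.forestLaw hq φ).toReal = φ.weight q / G.partitionFunction q := by
  rw [forestLaw, PMF.normalize_apply, ENNReal.toReal_mul, ENNReal.toReal_inv, tsum_fintype,
    ENNReal.toReal_sum fun _ _ => ENNReal.ofReal_ne_top,
    ENNReal.toReal_ofReal (φ.weight_nonneg hq), partitionFunction, div_eq_mul_inv]
  simp only [ENNReal.toReal_ofReal (RootedForest.weight_nonneg _ hq)]

variable {Ω : Type*} [MeasurableSpace Ω] {μ : Measure Ω} {Φ : Ω → G.RootedForest}

theorem integral_comp_forest (hq : 0 < q) (hΦ : HasLaw Φ (G.forestLaw hq).toMeasure μ)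
    (f : G.RootedForest → ℝ) :
    ∫ ω, f (Φ ω) ∂μ = ∑ φ, φ.weight q / G.partitionFunction q * f φ := by
  have h : ∫ ω, f (Φ ω) ∂μ = ∫ φ, f φ ∂(G.forestLaw hq).toMeasure := by
    rw [← hΦ.map_eq, integral_map hΦ.aemeasurable
      (Measurable.of_discrete (f := f)).aestronglyMeasurable]
  rw [h, PMF.integral_eq_sum]
  simp only [toReal_forestLaw, smul_eq_mul]

theorem memLp_comp_forest {E : Type*} [NormedAddCommGroup E]
    (hq : 0 < q) (hΦ : HasLaw Φ (G.forestLaw hq).toMeasure μ) (f : G.RootedForest → E) (p : ℝ≥0∞) :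
    MemLp (fun ω => f (Φ ω)) p μ := by
  have h : MemLp f p (μ.map Φ) := by
    rw [hΦ.map_eq]
    exact MemLp.of_discrete
  exact (memLp_map_measure_iff h.1 hΦ.aemeasurable).1 h

variable [DecidableEq V]

theorem sum_weight_mul_treeAverage (hq : 0 < q) (y : V → ℝ) (i : V) :
    ∑ φ : G.RootedForest, φ.weight q / G.partitionFunction q * φ.treeAverage y i =
      (G.smoother q *ᵥ y) i := by
  have hZ := (partitionFunction_pos (G := G) hq).ne'
  have hK : ∀ j, G.smoother q i j = ∑ φ : G.RootedForest, φ.weight q / G.partitionFunction q *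
      if j ∈ φ.tree i then 1 / ((φ.tree i).card : ℝ) else 0 := by
    intro j
    have h := G.sum_weight_div_card_tree q i j
    rw [rootWeight_eq_smul_smoother hq, Matrix.smul_apply, smul_eq_mul] at h
    simp only [div_mul_eq_mul_div, ← Finset.sum_div]
    rw [h, mul_div_cancel_left₀ _ hZ]
  simp only [Matrix.mulVec, dotProduct, hK, Finset.sum_mul]
  rw [Finset.sum_comm]
  refine Finset.sum_congr rfl fun φ _ => ?_
  rw [φ.treeAverage_eq_sum, Finset.mul_sum]
  exact Finset.sum_congr rfl fun j _ => (mul_assoc _ _ _).symm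

theorem integral_treeAverage (hq : 0 < q) (hΦ : HasLaw Φ (G.forestLaw hq).toMeasure μ)
    (y : V → ℝ) (i : V) :
    ∫ ω, (Φ ω).treeAverage y i ∂μ = (G.smoother q *ᵥ y) i := by
  rw [integral_comp_forest hq hΦ fun φ => φ.treeAverage y i, sum_weight_mul_treeAverage hq]

/-- The projection identity makes the squared norm linear in the estimator, so the second moment
follows from the mean alone. -/
theorem sum_integral_treeAverage_sq (hq : 0 < q) (hΦ : HasLaw Φ (G.forestLaw hq).toMeasure μ)
    (y : V → ℝ) :
    ∑ i, ∫ ω, (Φ ω).treeAverage y i ^ 2 ∂μ = y ⬝ᵥ G.smoother q *ᵥ y := by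
  rw [Finset.sum_congr rfl fun i _ =>
    integral_comp_forest hq hΦ fun φ => φ.treeAverage y i ^ 2]
  rw [Finset.sum_comm]
  simp only [← Finset.mul_sum, RootedForest.sum_treeAverage_sq]
  simp only [dotProduct, ← sum_weight_mul_treeAverage hq, Finset.mul_sum]
  rw [Finset.sum_comm]
  exact Finset.sum_congr rfl fun i _ => Finset.sum_congr rfl fun φ _ => mul_left_comm _ _ _

end Law

end WeightedGraph

end

theorem proposition2 {V : Type*} [Fintype V] [DecidableEq V] (G : WeightedGraph V)
    {q : ℝ} (hq : 0 < q) (y : V → ℝ)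
    {Ω : Type*} [MeasurableSpace Ω] (μ : Measure Ω) [IsProbabilityMeasure μ]
    (Φ : Ω → G.RootedForest) (hΦ : HasLaw Φ (G.forestLaw hq).toMeasure μ)
    (K : Matrix V V ℝ) (hK : K = G.smoother q)
    (xhat : V → ℝ) (hxhat : xhat = K *ᵥ y)
    (xbar : Ω → V → ℝ) (hxbar : ∀ ω i, xbar ω i = (Φ ω).treeAverage y i) :
    IsUnit (q • (1 : Matrix V V ℝ) + G.laplacian) ∧
    (∀ z, z ≠ xhat → G.objective q y xhat < G.objective q y z) ∧
    MemLp xbar 2 μ ∧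
    ∫ ω, xbar ω ∂μ = xhat ∧
    ∫ ω, ‖WithLp.toLp 2 (xbar ω - xhat)‖ ^ 2 ∂μ = ∑ i, Var[fun ω => xbar ω i; μ] ∧
    ∑ i, Var[fun ω => xbar ω i; μ] = y ⬝ᵥ (K - K ^ 2) *ᵥ y := by
  obtain rfl : xbar = fun ω i => (Φ ω).treeAverage y i := by
    funext ω i
    exact hxbar ω i
  subst hK hxhat
  have hmem : ∀ i, MemLp (fun ω => (Φ ω).treeAverage y i) 2 μ := fun i =>
    WeightedGraph.memLp_comp_forest hq hΦ (fun φ => φ.treeAverage y i) 2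
  have hmean := WeightedGraph.integral_treeAverage hq hΦ y
  refine ⟨WeightedGraph.isUnit_smul_one_add_laplacian hq,
    fun z hz => WeightedGraph.objective_smoother_mulVec_lt hq y hz,
    WeightedGraph.memLp_comp_forest hq hΦ (fun φ => φ.treeAverage y) 2, ?_, ?_, ?_⟩
  · funext i
    rw [eval_integral fun i => (hmem i).integrable one_le_two, hmean]
  · simp only [EuclideanSpace.real_norm_sq_eq, Pi.sub_apply]
    rw [integral_finsetSum]
    · refine Finset.sum_congr rfl fun i _ => ?_
      rw [variance_eq_integral (hmem i).1.aemeasurable, hmean]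
    · exact fun i _ => ((hmem i).sub (memLp_const _)).integrable_sq
  -- Variance is second moment minus squared mean; the squared means add up to `K y · K y`, which is
  -- `y · K² y` because `K` is symmetric.
  · simp only [variance_eq_sub (hmem _), Finset.sum_sub_distrib, Pi.pow_apply, hmean,
      WeightedGraph.sum_integral_treeAverage_sq hq hΦ]
    rw [Matrix.sub_mulVec, dotProduct_sub, sq (G.smoother q), ← Matrix.mulVec_mulVec,
      Matrix.dotProduct_mulVec y _ (_ *ᵥ _), ← Matrix.mulVec_transpose,
      WeightedGraph.smoother_isSymm.eq]
    simp only [dotProduct, sq]
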